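/- Let $(\mathcal V,\otimes,I)$ be a closed monoidal, locally presentable category (not assumed symmetric) with very flat monoidal product; that is, for every object $A$ and every nonempty jointly monic family $(\beta_j:B\to B_j)_{j\in J}$ in $\mathcal V$, indexed by a set $J$, the families $(\beta_j\otimes \mathrm{id}_A)_{j\in J}$ and $(\mathrm{id}_A\otimes\beta_j)_{j\in J}$ are jointly monic. (A family of morphisms $\beta_j:B\to B_j$ is jointly monic if $\beta_j f=\beta_j g$ for all $j$ implies $f=g$, for all $f,g:A\to B$.) Let $\mathsf{Coalg}(\mathcal V)$ be the category of (coassociative, counital) coalgebras in $\mathcal V$ and $U:\mathsf{Coalg}(\mathcal V)\to\mathcal V$ the forgetful functor. Let $\mathcal Z$ be a small category and $F:\mathcal Z\to\mathsf{Coalg}(\mathcal V)$ a functor. Then $U$ has a right adjoint $T^c$ (the cofree coalgebra functor), and the limits $L=\lim F$ in $\mathsf{Coalg}(\mathcal V)$ and $L'=\lim UF$ in $\mathcal V$ exist. Denote by $p:UT^cL'\to L'$ the counit of the adjunction $U\dashv T^c$ and by $\pi'_Z:L'\to UFZ$ the projections of the limit $L'$. A subcoalgebra of a coalgebra $T$ is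 a coalgebra $S$ with a coalgebra morphism $i:S\to T$ such that $Ui$ is a monomorphism in $\mathcal V$. (i) Among the subcoalgebras $i:S\to T^cL'$ such that for every object $Z$ of $\mathcal Z$ the composite $$US\xrightarrow{\;Ui\;}UT^cL'\xrightarrow{\;p\;}L'\xrightarrow{\;\pi'_Z\;}UFZ$$ is the underlying morphism of a coalgebra morphism $\pi_Z:S\to FZ$, there is a largest one (every other such subcoalgebra factors through it by a coalgebra morphism). This largest subcoalgebra, together with the morphisms $\pi_Z$, is a limit of $F$; and conversely every limit of $F$ is in this way the largest such subcoalgebra, with the $\pi_Z$ being exactly its canonical projections. (ii) For a coalgebra $(C,\Delta,\epsilon)$ define $\Delta^n:C\to C^{\otimes n}$ by $\Delta^0=\epsilon:C\to I$ and $\Delta^n=(\Delta^{n-1}\otimes\mathrm{id}_C)\circ\Delta$ for $n>0$. If $L=\lim F$ has projections $\pi_Z:L\to FZ$, then the family of morphisms $$(\pi_{Z_1}\otimes\cdots\otimes\pi_{Z_n})\circ\Delta_L^n:\;L\to FZ_1\otimes\cdots\otimes FZ_n,$$ indexed by all $n\in\mathbb N=\{0,1,2,\dots\}$ and all objects $Z_1,\dots,Z_n$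 of $\mathcal Z$, is jointly monic in $\mathcal V$. -/

import Mathlib

open CategoryTheory CategoryTheory.Limits CategoryTheory.MonoidalCategory

universe w v u

namespace CoalgLimits

section Families

variable {V : Type u} [Category.{v} V]

/-- A family of morphisms with common domain `B` is jointly monic if two morphisms into `B`
that agree after composition with every member of the family are equal. -/
def JointlyMonic {I : Type w} {B : V} {X : I → V} (β : ∀ i, B ⟶ X i) : Prop :=
  ∀ ⦃A : V⦄ (f g : A ⟶ B), (∀ i, f ≫ β i = g ≫ β i) → f = g

end Families

section Monoidal

variable {V : Type u} [Category.{v} V] [MonoidalCategory V]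

/-- An object `A` is (two-sided) very flat if both `- ⊗ A` and `A ⊗ -` preserve jointly monic
families indexed by nonempty (small) sets. -/
def VeryFlat (A : V) : Prop :=
  ∀ ⦃I : Type v⦄ [Nonempty I] ⦃B : V⦄ ⦃X : I → V⦄ (β : ∀ i, B ⟶ X i), JointlyMonic β →
    JointlyMonic (fun i => β i ▷ A) ∧ JointlyMonic (fun i => A ◁ β i)

variable (V) in
/-- The monoidal product of `V` is very flat if every object is very flat. -/
def HasVeryFlatTensor : Prop :=
  ∀ A : V, VeryFlat A

/-- The iterated tensor product `X 0 ⊗ ⋯ ⊗ X (n - 1)`, bracketed to the left and starting with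
the unit object: `(((𝟙_ V ⊗ X 0) ⊗ X 1) ⊗ ⋯) ⊗ X (n - 1)`; for `n = 0` it is `𝟙_ V`. -/
def tensorFin : ∀ {n : ℕ}, (Fin n → V) → V
  | 0, _ => 𝟙_ V
  | n + 1, X => tensorFin (fun i : Fin n => X i.castSucc) ⊗ X (Fin.last n)

/-- The iterated tensor product `f 0 ⊗ ⋯ ⊗ f (n - 1)` of morphisms. -/
def tensorFinMap : ∀ {n : ℕ} {X Y : Fin n → V}, (∀ i, X i ⟶ Y i) → (tensorFin X ⟶ tensorFin Y)
  | 0, _, _, _ => 𝟙 (𝟙_ V)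
  | n + 1, _, _, f => tensorFinMap (fun i : Fin n => f i.castSucc) ⊗ₘ f (Fin.last n)

/-- The iterated comultiplication `Δⁿ : C ⟶ C ⊗ ⋯ ⊗ C` (`n` factors) of a coalgebra:
`Δ⁰ = ε` and `Δⁿ⁺¹ = (Δⁿ ⊗ id) ∘ Δ`. -/
def iterComul (C : Comon V) : ∀ n : ℕ, C.X ⟶ tensorFin (fun _ : Fin n => C.X)
  | 0 => ComonObj.counit
  | n + 1 => ComonObj.comul ≫ (iterComul C n ▷ C.X)

/-- A subcoalgebra of `T`: a coalgebra with a coalgebra morphism to `T` whose underlying morphism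
is a monomorphism in `V`. -/
structure Subcoalgebra (T : Comon V) where
  /-- the coalgebra -/
  obj : Comon V
  /-- the inclusion -/
  ι : obj ⟶ T
  mono : Mono ι.hom

/-- `S` is the largest subcoalgebra of `T` with the property `P`: it has the property, and every
subcoalgebra with the property factors through it. -/
def Subcoalgebra.IsLargest {T : Comon V} (P : Subcoalgebra T → Prop) (S : Subcoalgebra T) : Prop :=
  P S ∧ ∀ S' : Subcoalgebra T, P S' → ∃ k : S'.obj ⟶ S.obj, k ≫ S.ι = S'.ι

variable {Z : Type v} [SmallCategory Z] (F : Z ⥤ Comon V) {Tc : V ⥤ Comon V}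
  (adj : Comon.forget V ⊣ Tc) (L' : Cone (F ⋙ Comon.forget V))

/-- For a cone `L'` over `UF` with legs `π'_Z`, and a subcoalgebra `i : S ⟶ Tᶜ L'` of the cofree
coalgebra on its vertex, the composite
`U S ⟶ U Tᶜ L' ⟶ L' ⟶ U F Z` of `U i`, the counit `p` of `U ⊣ Tᶜ`, and `π'_Z`. -/
def projHom (S : Subcoalgebra (Tc.obj L'.pt)) (z : Z) : S.obj.X ⟶ (F.obj z).X :=
  S.ι.hom ≫ adj.counit.app L'.pt ≫ L'.π.app z

/-- All the composites `projHom` underlie coalgebra morphisms. -/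
def ProjectsToCoalg (S : Subcoalgebra (Tc.obj L'.pt)) : Prop :=
  ∀ z : Z, IsComonHom (projHom F adj L' S z)

end Monoidal

end CoalgLimits

/-! Fix morphisms `f i : C ⟶ Y i` out of a coalgebra and call `C` reduced when its iterated
comultiplications, followed by tensor products of the `f i`, are jointly monic. Factor the induced
map from `C` to the product of all word tensors as a strong epi followed by a mono. Very flatness
keeps the components of the mono jointly monic after tensoring them in pairs, so the coalgebra
structure descends to the image, which is a reduced quotient (`exists_reduced_quotient`). A reduced
coalgebra is a subobject of one fixed object, so there is essentially a set of them. Reducing their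
coproduct gives a terminal object (`exists_terminal_of_property`): the cofree coalgebra for a single
`Y` with no condition, the limit when the `f i` must form a cone of coalgebra morphisms. The reduced
quotient of a limit is again a cone, so the quotient map is split mono
(`IsComonCone.mono_of_isLimit`). Applied to the projections this gives (ii); applied to the
comparison with `L'` it embeds the limit in the cofree coalgebra, whence (i). -/

namespace CoalgLimits

/-! ### Completeness and well-poweredness of locally presentable categories -/

section LocallyPresentable

variable (V : Type u) [Category.{v} V]

/-- A locally presentable category is cocomplete. -/
lemma hasColimits_of_isLocallyPresentable [IsLocallyPresentable.{v} V] :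
    HasColimitsOfSize.{v, v} V := by
  obtain ⟨κ, _, _⟩ := IsLocallyPresentable.exists_cardinal.{v} V
  exact IsCardinalLocallyPresentable.toHasColimitsOfSize κ

/-- A locally presentable category is complete: it is reflective in presheaves on a small dense
subcategory. -/
lemma hasLimits_of_isLocallyPresentable [IsLocallyPresentable.{v} V] :
    HasLimitsOfSize.{v, v} V := by
  have := hasColimits_of_isLocallyPresentable V
  obtain ⟨κ, _, _⟩ := IsLocallyPresentable.exists_cardinal.{v} V
  let A : SmallModel.{v} (isCardinalPresentable V κ).FullSubcategory ⥤ V :=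
    (equivSmallModel.{v} (isCardinalPresentable V κ).FullSubcategory).inverse ⋙
      (isCardinalPresentable V κ).ι
  have : A.IsDense := inferInstance
  let R := Presheaf.restrictedULiftYoneda.{v} A
  have : uliftYoneda.{v}.HasPointwiseLeftKanExtension A := inferInstance
  let _ : Reflective R :=
    { L := _
      adj := Presheaf.uliftYonedaAdjunction.{v} _ (uliftYoneda.{v}.leftKanExtensionUnit A) }
  exact hasLimits_of_reflective R

/-- A locally presentable category is well-powered. -/
lemma wellPowered_of_isLocallyPresentable [IsLocallyPresentable.{v} V] : WellPowered.{v} V := by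
  have := hasLimits_of_isLocallyPresentable V
  obtain ⟨κ, _, _⟩ := IsLocallyPresentable.exists_cardinal.{v} V
  obtain ⟨P, _, hP⟩ := HasCardinalFilteredGenerator.exists_small_generator V κ
  refine wellPowered_of_isDetecting (𝒢 := P) fun X Y f hf => ?_
  have : Mono f := (hP.isStrongGenerator.isSeparating.mono_iff f).2
    fun G hG g₁ g₂ h => (hf G hG (g₂ ≫ f)).unique h rfl
  exact hP.isStrongGenerator.isIso_of_mono f fun G hG g => (hf G hG g).exists

end LocallyPresentable

/-! ### Strong epi-mono factorizations -/

section Factorization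

variable {V : Type u} [Category.{v} V]

/-- In a complete well-powered category, every morphism is a strong epimorphism followed by a
monomorphism. -/
lemma exists_strongEpi_mono_factorization [HasLimitsOfSize.{v, v} V] [WellPowered.{v} V]
    {X Y : V} (f : X ⟶ Y) :
    ∃ (E : V) (e : X ⟶ E) (m : E ⟶ Y), StrongEpi e ∧ Mono m ∧ e ≫ m = f := by
  -- The image is the smallest subobject of `Y` through which `f` factors.
  let T : Set (Subobject Y) := {p | p.Factors f}
  let S : Subobject Y := Subobject.sInf.{v} T
  have hT : ∀ j : ↑(equivShrink.{v} (Subobject Y) '' T),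
      ((equivShrink.{v} (Subobject Y)).symm j).Factors f := by
    rintro ⟨-, p, hp, rfl⟩
    simpa [T] using hp
  have hS : S.Factors f := (Subobject.mk_factors_iff _ _).2
    ⟨limit.lift (Subobject.wideCospan.{v} T) (WidePullbackShape.mkCone f
      (fun j => Subobject.factorThru _ f (hT j)) fun j => Subobject.factorThru_arrow _ _ _),
      limit.lift_π _ _⟩
  let e := S.factorThru f hS
  -- Minimality: a mono into `S` through which `e` factors is split epi. An equalizer then shows
  -- that `e` is epi, a pullback that it is strong.
  have key : ∀ {K : V} (k : K ⟶ (S : V)) [Mono k] (a : X ⟶ K), a ≫ k = e →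
      ∃ s : (S : V) ⟶ K, s ≫ k = 𝟙 _ := by
    intro K k _ a ha
    have hle : S ≤ Subobject.mk (k ≫ S.arrow) := Subobject.sInf_le.{v} T _ <| by
      change (Subobject.mk (k ≫ S.arrow)).Factors f
      exact (Subobject.mk_factors_iff _ _).2 ⟨a, by
        change a ≫ k ≫ S.arrow = f
        rw [reassoc_of% ha, Subobject.factorThru_arrow]⟩
    refine ⟨S.ofLEMk _ hle, ?_⟩
    rw [← cancel_mono S.arrow, Category.assoc, Subobject.ofLEMk_comp, Category.id_comp]
  refine ⟨S, e, S.arrow, ⟨⟨fun {Z} g h hgh => ?_⟩, fun {A B} m _ => ⟨fun {u w} sq => ?_⟩⟩,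
    inferInstance, S.factorThru_arrow f hS⟩
  · obtain ⟨s, hs⟩ := key (equalizer.ι g h) (equalizer.lift e hgh) (equalizer.lift_ι _ _)
    rw [← Category.id_comp g, ← Category.id_comp h, ← hs, Category.assoc, Category.assoc,
      equalizer.condition]
  · obtain ⟨s, hs⟩ := key (pullback.snd m w) (pullback.lift u e sq.w) (pullback.lift_snd _ _ _)
    have hl : (s ≫ pullback.fst m w) ≫ m = w := by
      rw [Category.assoc, pullback.condition, reassoc_of% hs]
    exact ⟨⟨⟨s ≫ pullback.fst m w, by
      rw [← cancel_mono m, Category.assoc, hl, sq.w], hl⟩⟩⟩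

end Factorization

/-! ### Jointly monic families and tensor products -/

section JointlyMonic

variable {V : Type u} [Category.{v} V]

lemma JointlyMonic.mono_comp {I : Type w} {A B : V} {X : I → V} {β : ∀ i, B ⟶ X i}
    (hβ : JointlyMonic β) (m : A ⟶ B) [Mono m] : JointlyMonic fun i => m ≫ β i :=
  fun _ f g h => (cancel_mono m).1 <| hβ _ _ fun i => by simpa using h i

lemma JointlyMonic.mono_lift {I : Type w} {B : V} {X : I → V} [HasProduct X] {β : ∀ i, B ⟶ X i}
    (hβ : JointlyMonic β) : Mono (Pi.lift β) :=
  ⟨fun f g h => hβ f g fun i => by simpa using congr($h ≫ Pi.π X i)⟩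

lemma jointlyMonic_of_mono_lift {I : Type w} {B : V} {X : I → V} [HasProduct X]
    (β : ∀ i, B ⟶ X i) [Mono (Pi.lift β)] : JointlyMonic β :=
  fun _ f g h => (cancel_mono (Pi.lift β)).1 <| Pi.hom_ext _ _ fun i => by simpa using h i

variable [MonoidalCategory V]

/-- Very flatness is applied to one factor at a time, through `β i ⊗ γ j = (β i ▷ B) ≫ (X i ◁ γ j)`.
-/
lemma HasVeryFlatTensor.jointlyMonic_tensorHom (hV : HasVeryFlatTensor V) {I J : Type v}
    [Nonempty I] [Nonempty J] {A B : V} {X : I → V} {Y : J → V} {β : ∀ i, A ⟶ X i}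
    {γ : ∀ j, B ⟶ Y j} (hβ : JointlyMonic β) (hγ : JointlyMonic γ) :
    JointlyMonic fun p : I × J => β p.1 ⊗ₘ γ p.2 := by
  intro W f g h
  refine (hV B β hβ).1 f g fun i => (hV (X i) γ hγ).2 _ _ fun j => ?_
  simpa [MonoidalCategory.tensorHom_def] using h (i, j)

end JointlyMonic

/-! ### Iterated comultiplication along words -/

section Words

variable {V : Type u} [Category.{v} V] [MonoidalCategory V] {I : Type w} (Y : I → V)

/-- The tensor product of the objects `Y i` along a word in the letters `i`, read from right to
left and bracketed to the left. -/
def wordTensor : List I → V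
  | [] => 𝟙_ V
  | i :: l => wordTensor l ⊗ Y i

variable {Y}

/-- The iterated comultiplication of `C` followed by the tensor product of the morphisms `f i`
along a word. -/
def wordComul (C : Comon V) (f : ∀ i, C.X ⟶ Y i) : ∀ l : List I, C.X ⟶ wordTensor Y l
  | [] => ComonObj.counit
  | i :: l => ComonObj.comul ≫ (wordComul C f l ⊗ₘ f i)

variable (Y) in
/-- The canonical morphism from the tensor product along a concatenation. -/
def wordSplit (l : List I) : ∀ l' : List I,
    wordTensor Y (l' ++ l) ⟶ wordTensor Y l ⊗ wordTensor Y l'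
  | [] => (ρ_ (wordTensor Y l)).inv
  | i :: l' => (wordSplit l l' ▷ Y i) ≫ (α_ _ _ _).hom

/-- Coassociativity, by induction on `l'`, with the counit law as base case. It expresses the
components of the comultiplication through single words, which is what lets the comultiplication
pass to images. -/
lemma wordComul_append (C : Comon V) (f : ∀ i, C.X ⟶ Y i) (l : List I) : ∀ l' : List I,
    wordComul C f (l' ++ l) ≫ wordSplit Y l l' =
      ComonObj.comul ≫ (wordComul C f l ⊗ₘ wordComul C f l')
  | [] => (ComonObj.comul_counit_hom (wordComul C f l)).symm
  | i :: l' => by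
    calc (ComonObj.comul ≫ (wordComul C f (l' ++ l) ⊗ₘ f i)) ≫
          (wordSplit Y l l' ▷ Y i) ≫ (α_ _ _ _).hom
        = ComonObj.comul ≫ ((wordComul C f (l' ++ l) ≫ wordSplit Y l l') ⊗ₘ f i) ≫
            (α_ _ _ _).hom := by
          simp [tensorHom_comp_whiskerRight_assoc]
      _ = ComonObj.comul ≫ ((ComonObj.comul ≫ (wordComul C f l ⊗ₘ wordComul C f l')) ⊗ₘ f i) ≫
            (α_ _ _ _).hom := by rw [wordComul_append C f l l']
      _ = ComonObj.comul ≫ (ComonObj.comul ▷ C.X) ≫ (α_ _ _ _).hom ≫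
            (wordComul C f l ⊗ₘ (wordComul C f l' ⊗ₘ f i)) := by
          rw [← associator_naturality, whiskerRight_comp_tensorHom_assoc]
      _ = ComonObj.comul ≫ (wordComul C f l ⊗ₘ
            (ComonObj.comul ≫ (wordComul C f l' ⊗ₘ f i))) := by
          rw [← ComonObj.comul_assoc_assoc, whiskerLeft_comp_tensorHom]

variable (Y) in
/-- The canonical morphism from the tensor product along a word with one letter. -/
def wordSingle (i : I) : wordTensor Y [i] ⟶ Y i :=
  (λ_ (Y i)).hom

lemma wordComul_singleton (C : Comon V) (f : ∀ i, C.X ⟶ Y i) (i : I) :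
    wordComul C f [i] ≫ wordSingle Y i = f i := by
  change (ComonObj.comul ≫ (ComonObj.counit ⊗ₘ f i)) ≫ (λ_ (Y i)).hom = f i
  simp

lemma comp_wordComul {C D : Comon V} (k : C ⟶ D) (f : ∀ i, C.X ⟶ Y i) (g : ∀ i, D.X ⟶ Y i)
    (h : ∀ i, k.hom ≫ g i = f i) : ∀ l : List I, k.hom ≫ wordComul D g l = wordComul C f l
  | [] => IsComonHom.hom_counit k.hom
  | i :: l => by
    change k.hom ≫ ComonObj.comul ≫ (wordComul D g l ⊗ₘ g i) =
      ComonObj.comul ≫ (wordComul C f l ⊗ₘ f i)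
    rw [IsComonHom.hom_comul_assoc, tensorHom_comp_tensorHom, comp_wordComul k f g h l, h i]

lemma eq_of_wordComul {C D : Comon V} {f : ∀ i, C.X ⟶ Y i} {g : ∀ i, D.X ⟶ Y i}
    (k : C.X ⟶ D.X) (h : ∀ l, k ≫ wordComul D g l = wordComul C f l) (i : I) :
    k ≫ g i = f i := by
  rw [← wordComul_singleton D g i, ← wordComul_singleton C f i, ← Category.assoc, h]

end Words

/-! ### Reduced quotients and coproducts of coalgebras -/

section Reduced

variable {V : Type u} [Category.{v} V] [MonoidalCategory V] {I : Type v} {Y : I → V}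

/-- The empty word gives the counit. The comultiplication is tested against pairs of words, which
concatenation turns into single words. -/
lemma isComonHom_of_wordComul (hV : HasVeryFlatTensor V) {C D : Comon V} {f : ∀ i, C.X ⟶ Y i}
    {g : ∀ i, D.X ⟶ Y i} (hg : JointlyMonic (wordComul D g)) (k : C.X ⟶ D.X)
    (h : ∀ l, k ≫ wordComul D g l = wordComul C f l) : IsComonHom k where
  hom_counit := h []
  hom_comul := hV.jointlyMonic_tensorHom hg hg _ _ fun ⟨l, l'⟩ => by
    simp only [Category.assoc, tensorHom_comp_tensorHom, h]
    rw [← wordComul_append, ← wordComul_append, reassoc_of% h]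

/-- Every coalgebra `C` with morphisms `f i : C ⟶ Y i` has a quotient coalgebra on which the
composites of iterated comultiplications and tensor products of the induced morphisms are
jointly monic. -/
lemma exists_reduced_quotient (hV : HasVeryFlatTensor V) [HasLimitsOfSize.{v, v} V]
    [WellPowered.{v} V] (C : Comon V) (f : ∀ i, C.X ⟶ Y i) :
    ∃ (E : Comon V) (e : C ⟶ E) (g : ∀ i, E.X ⟶ Y i), StrongEpi e.hom ∧
      (∀ i, e.hom ≫ g i = f i) ∧ JointlyMonic (wordComul E g) := by
  obtain ⟨E, e, m, _, _, hem⟩ := exists_strongEpi_mono_factorization (Pi.lift (wordComul C f))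
  let μ (l : List I) : E ⟶ wordTensor Y l := m ≫ Pi.π _ l
  have hμ : JointlyMonic μ := by
    intro W a b h
    exact (cancel_mono m).1 <| Pi.hom_ext _ _ fun l => by simpa [μ] using h l
  have heμ (l : List I) : e ≫ μ l = wordComul C f l := by
    simp [μ, reassoc_of% hem]
  have hμμ := hV.jointlyMonic_tensorHom hμ hμ
  have := hμμ.mono_lift
  -- The right side is mono by very flatness and `e` is a strong epi; the diagonal is the
  -- comultiplication of `E`.
  have sq : CommSq (ComonObj.comul ≫ (e ⊗ₘ e)) e
      (Pi.lift fun p : List I × List I => μ p.1 ⊗ₘ μ p.2)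
      (Pi.lift fun p : List I × List I => μ (p.2 ++ p.1) ≫ wordSplit Y p.1 p.2) :=
    ⟨Pi.hom_ext _ _ fun p => by
      simp [tensorHom_comp_tensorHom, heμ, reassoc_of% heμ, wordComul_append]⟩
  have he : e ≫ sq.lift = ComonObj.comul ≫ (e ⊗ₘ e) := sq.fac_left
  let η : E ⟶ 𝟙_ V := μ []
  have hc : e ≫ η = ComonObj.counit := heμ []
  let _ : ComonObj E :=
    { counit := η
      comul := sq.lift
      counit_comul := by
        rw [← cancel_epi e, reassoc_of% he, tensorHom_comp_whiskerRight, hc,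
          ComonObj.counit_comul_hom]
      comul_counit := by
        rw [← cancel_epi e, reassoc_of% he, tensorHom_comp_whiskerLeft, hc,
          ComonObj.comul_counit_hom]
      comul_assoc := by
        rw [← cancel_epi e, reassoc_of% he, reassoc_of% he, tensorHom_comp_whiskerLeft, he,
          tensorHom_comp_whiskerRight_assoc, he, ← whiskerLeft_comp_tensorHom,
          ← whiskerRight_comp_tensorHom, Category.assoc, associator_naturality,
          ComonObj.comul_assoc_assoc] }
  have : IsComonHom e := ⟨hc, he⟩
  let e' : C ⟶ Comon.mk E := ⟨e⟩
  have hfg (i : I) : e ≫ μ [i] ≫ wordSingle Y i = f i := by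
    rw [reassoc_of% heμ, wordComul_singleton]
  refine ⟨⟨E⟩, e', fun i => μ [i] ≫ wordSingle Y i, inferInstance, hfg, ?_⟩
  have h : wordComul ⟨E⟩ (fun i => μ [i] ≫ wordSingle Y i) = μ := funext fun l => by
    rw [← cancel_epi e, heμ]
    exact comp_wordComul e' _ _ hfg l
  rwa [h]

/-- A coproduct of coalgebras, constructed on the coproduct of the underlying objects. -/
lemma exists_coproduct_comon [HasColimitsOfSize.{v, v} V] {J : Type v} (C : J → Comon V) :
    ∃ (W : Comon V) (ι : ∀ j, C j ⟶ W),
      Nonempty (IsColimit (Cofan.mk W.X fun j => (ι j).hom)) := by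
  let X (j : J) : V := (C j).X
  let s (j : J) : (C j).X ⟶ ∐ X := Limits.Sigma.ι X j
  -- Only morphisms out of the coproduct are constructed or compared, so the tensor product need not
  -- preserve it.
  let Δ : (∐ X) ⟶ (∐ X) ⊗ (∐ X) := Limits.Sigma.desc fun j => ComonObj.comul ≫ (s j ⊗ₘ s j)
  let ε : ∐ X ⟶ 𝟙_ V := Limits.Sigma.desc fun j => ComonObj.counit (X := (C j).X)
  have hΔ (j : J) : s j ≫ Δ = ComonObj.comul ≫ (s j ⊗ₘ s j) := Limits.Sigma.ι_desc _ _
  have hε (j : J) : s j ≫ ε = ComonObj.counit := Limits.Sigma.ι_desc _ _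
  let _ : ComonObj (∐ X) :=
    { counit := ε
      comul := Δ
      counit_comul := Limits.Sigma.hom_ext _ _ fun j => by
        change s j ≫ _ = s j ≫ _
        rw [reassoc_of% hΔ, tensorHom_comp_whiskerRight, hε, ComonObj.counit_comul_hom]
      comul_counit := Limits.Sigma.hom_ext _ _ fun j => by
        change s j ≫ _ = s j ≫ _
        rw [reassoc_of% hΔ, tensorHom_comp_whiskerLeft, hε, ComonObj.comul_counit_hom]
      comul_assoc := Limits.Sigma.hom_ext _ _ fun j => by
        change s j ≫ _ = s j ≫ _
        rw [reassoc_of% hΔ, reassoc_of% hΔ, tensorHom_comp_whiskerLeft, hΔ,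
          tensorHom_comp_whiskerRight_assoc, hΔ, ← whiskerLeft_comp_tensorHom,
          ← whiskerRight_comp_tensorHom, Category.assoc, associator_naturality,
          ComonObj.comul_assoc_assoc] }
  have (j : J) : IsComonHom (s j) := ⟨hε j, hΔ j⟩
  exact ⟨⟨∐ X⟩, fun j => ⟨s j⟩, ⟨coproductIsCoproduct X⟩⟩

end Reduced

variable {V : Type u} [Category.{v} V] [MonoidalCategory V]

/-! ### Terminal coalgebras over a family of objects -/

section Terminal

variable {I : Type v} {Y : I → V}

/-- Let `Q` be a property of coalgebras `C` with morphisms `f i : C ⟶ Y i` which passes to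
coproducts and quotients. Then there is a terminal object among those with this property. -/
theorem exists_terminal_of_property (hV : HasVeryFlatTensor V) [HasLimitsOfSize.{v, v} V]
    [HasColimitsOfSize.{v, v} V] [WellPowered.{v} V]
    (Q : ∀ C : Comon V, (∀ i, C.X ⟶ Y i) → Prop)
    (hquot : ∀ {C E : Comon V} (e : C ⟶ E) [Epi e.hom] (g : ∀ i, E.X ⟶ Y i),
      Q C (fun i => e.hom ≫ g i) → Q E g)
    (hcoprod : ∀ {J : Type v} {C : J → Comon V} {W : Comon V} (ι : ∀ j, C j ⟶ W)
      (_ : IsColimit (Cofan.mk W.X fun j => (ι j).hom)) (g : ∀ i, W.X ⟶ Y i),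
      (∀ j, Q (C j) fun i => (ι j).hom ≫ g i) → Q W g) :
    ∃ (T : Comon V) (t : ∀ i, T.X ⟶ Y i), Q T t ∧
      ∀ (C : Comon V) (f : ∀ i, C.X ⟶ Y i), Q C f →
        ∃! k : C ⟶ T, ∀ i, k.hom ≫ t i = f i := by
  let P : V := ∏ᶜ fun l : List I => wordTensor Y l
  -- The subobjects of `P` carried by reduced coalgebras with property `Q`; `C j` is one
  -- representative of each.
  let S : Set (Subobject P) := {p | ∃ (C : Comon V) (f : ∀ i, C.X ⟶ Y i)
    (_ : Mono (Pi.lift (wordComul C f))), Q C f ∧ Subobject.mk (Pi.lift (wordComul C f)) = p}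
  let J : Type v := Shrink.{v} S
  choose C f hm hQ hp using fun j : J => ((equivShrink.{v} S).symm j).2
  obtain ⟨W, ι, ⟨hW⟩⟩ := exists_coproduct_comon C
  let w (i : I) : W.X ⟶ Y i := Cofan.IsColimit.desc hW fun j => f j i
  have hw (i : I) (j : J) : (ι j).hom ≫ w i = f j i := Cofan.IsColimit.fac hW _ _
  -- The coproduct is only weakly terminal; reducing it makes morphisms into it unique.
  obtain ⟨T, e, t, _, het, ht⟩ := exists_reduced_quotient hV W w
  refine ⟨T, t, hquot e t ?_, fun D d hD => ?_⟩
  · simp only [het]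
    exact hcoprod ι hW w fun j => by simpa only [hw] using hQ j
  -- The reduced quotient of `D` gives the same subobject of `P` as some `C j`, and the comparison
  -- preserves words, hence is a coalgebra morphism.
  · obtain ⟨E, q, g, _, hqg, hg⟩ := exists_reduced_quotient hV D d
    have hE : Q E g := hquot q g (by simpa only [hqg] using hD)
    have := hg.mono_lift
    let s : S := ⟨Subobject.mk (Pi.lift (wordComul E g)), E, g, inferInstance, hE, rfl⟩
    let j : J := equivShrink.{v} S s
    have hle : Subobject.mk (Pi.lift (wordComul E g)) ≤
        Subobject.mk (Pi.lift (wordComul (C j) (f j))) := by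
      rw [hp j]
      simp [j, s]
    let k := Subobject.ofMkLEMk _ _ hle
    have hk (l : List I) : k ≫ wordComul (C j) (f j) l = wordComul E g l := by
      have h : k ≫ Pi.lift (wordComul (C j) (f j)) = Pi.lift (wordComul E g) :=
        Subobject.ofMkLEMk_comp hle
      simpa using congr($h ≫ Pi.π _ l)
    have := isComonHom_of_wordComul hV
      (jointlyMonic_of_mono_lift (wordComul (C j) (f j))) k hk
    let k' : E ⟶ C j := ⟨k⟩
    have hk' (i : I) : k ≫ f j i = g i := eq_of_wordComul k hk i
    refine ⟨q ≫ k' ≫ ι j ≫ e, fun i => ?_, fun a ha => ?_⟩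
    · change (q.hom ≫ k ≫ (ι j).hom ≫ e.hom) ≫ t i = d i
      simp only [Category.assoc, het, hw, hk', hqg]
    · ext
      refine ht _ _ fun l => ?_
      rw [comp_wordComul _ _ _ ha, comp_wordComul (f := d)]
      intro i
      change (q.hom ≫ k ≫ (ι j).hom ≫ e.hom) ≫ t i = d i
      simp only [Category.assoc, het, hw, hk', hqg]

/-- The forgetful functor from coalgebras has a right adjoint. -/
theorem isLeftAdjoint_forget (hV : HasVeryFlatTensor V) [HasLimitsOfSize.{v, v} V]
    [HasColimitsOfSize.{v, v} V] [WellPowered.{v} V] : (Comon.forget V).IsLeftAdjoint := by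
  refine isLeftAdjoint_iff_hasTerminal_costructuredArrow.2 fun A => ?_
  obtain ⟨T, t, -, hT⟩ := exists_terminal_of_property (I := PUnit.{v + 1}) (Y := fun _ => A) hV
    (fun _ _ => True) (fun _ _ _ _ => trivial) (fun _ _ _ _ => trivial)
  let X : CostructuredArrow (Comon.forget V) A := CostructuredArrow.mk (t ⟨⟩)
  choose k hk huniq using fun B : CostructuredArrow (Comon.forget V) A =>
    hT B.left (fun _ => B.hom) trivial
  exact (IsTerminal.ofUniqueHom (Y := X)
    (fun B => CostructuredArrow.homMk (k B) (hk B ⟨⟩))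
    fun B m => CostructuredArrow.hom_ext _ _
      (huniq B m.left fun _ => CostructuredArrow.w m)).hasTerminal

end Terminal

/-! ### Limits of coalgebras -/

section Limits

variable {Z : Type v} [SmallCategory Z] (F : Z ⥤ Comon V)

/-- The condition that morphisms `f z : C ⟶ F z` are coalgebra morphisms forming a cone. -/
def IsComonCone (C : Comon V) (f : ∀ z, C.X ⟶ (F.obj z).X) : Prop :=
  (∀ z, IsComonHom (f z)) ∧ ∀ ⦃z z' : Z⦄ (a : z ⟶ z'), f z ≫ (F.map a).hom = f z'

variable {F}

/-- The cone of coalgebras with given underlying morphisms. -/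
@[simps]
def IsComonCone.cone {C : Comon V} {f : ∀ z, C.X ⟶ (F.obj z).X} (hf : IsComonCone F C f) :
    Cone F where
  pt := C
  π :=
    { app := fun z => { hom := f z, isComonHom_hom := hf.1 z }
      naturality := fun z z' a => by
        ext
        change 𝟙 _ ≫ f z' = f z ≫ (F.map a).hom
        rw [hf.2 a, Category.id_comp] }

lemma isComonCone_of_cone (s : Cone F) : IsComonCone F s.pt fun z => (s.π.app z).hom :=
  ⟨fun _ => inferInstance, fun _ _ a => congr(($(s.w a)).hom)⟩

lemma isComonHom_of_epi_comp {C E D : Comon V} (e : C ⟶ E) [Epi e.hom] (g : E.X ⟶ D.X)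
    [h : IsComonHom (e.hom ≫ g)] : IsComonHom g where
  hom_counit := by
    rw [← cancel_epi e.hom, ← Category.assoc, h.hom_counit, IsComonHom.hom_counit]
  hom_comul := by
    rw [← cancel_epi e.hom, ← Category.assoc, h.hom_comul, IsComonHom.hom_comul_assoc,
      tensorHom_comp_tensorHom]

lemma IsComonCone.of_epi_comp {C E : Comon V} (e : C ⟶ E) [Epi e.hom]
    (g : ∀ z, E.X ⟶ (F.obj z).X) (h : IsComonCone F C fun z => e.hom ≫ g z) :
    IsComonCone F E g :=
  ⟨fun z => have := h.1 z; isComonHom_of_epi_comp e (g z),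
    fun z z' a => by rw [← cancel_epi e.hom, ← Category.assoc, h.2 a]⟩

lemma IsComonCone.of_coproduct {J : Type v} {C : J → Comon V} {W : Comon V} (ι : ∀ j, C j ⟶ W)
    (hW : IsColimit (Cofan.mk W.X fun j => (ι j).hom)) (g : ∀ z, W.X ⟶ (F.obj z).X)
    (h : ∀ j, IsComonCone F (C j) fun z => (ι j).hom ≫ g z) : IsComonCone F W g := by
  have ext {A : V} {a b : W.X ⟶ A} (hab : ∀ j, (ι j).hom ≫ a = (ι j).hom ≫ b) : a = b :=
    Cofan.IsColimit.hom_ext hW _ _ hab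
  refine ⟨fun z => ⟨ext fun j => ?_, ext fun j => ?_⟩, fun z z' a => ext fun j => ?_⟩
  · have := (h j).1 z
    rw [← Category.assoc, this.hom_counit, IsComonHom.hom_counit]
  · have := (h j).1 z
    rw [← Category.assoc, this.hom_comul, IsComonHom.hom_comul_assoc, tensorHom_comp_tensorHom]
  · rw [← Category.assoc, (h j).2 a]

/-- The category of coalgebras has small limits. -/
theorem hasLimit_comon (hV : HasVeryFlatTensor V) [HasLimitsOfSize.{v, v} V]
    [HasColimitsOfSize.{v, v} V] [WellPowered.{v} V] (F : Z ⥤ Comon V) : HasLimit F := by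
  obtain ⟨T, t, ht, hT⟩ := exists_terminal_of_property hV (IsComonCone F)
    (fun e _ => IsComonCone.of_epi_comp e) IsComonCone.of_coproduct
  choose k hk huniq using fun s : Cone F => hT _ _ (isComonCone_of_cone s)
  exact ⟨⟨ht.cone, ⟨k, fun s z => Comon.ext (hk s z),
    fun s m hm => huniq s m fun z => congr(($(hm z)).hom)⟩⟩⟩

/-- The universal property of `L` gives a morphism `E ⟶ L.pt` which is a retraction of `e`. -/
lemma IsComonCone.mono_of_isLimit {L : Cone F} (hL : IsLimit L) {E : Comon V}
    {g : ∀ z, E.X ⟶ (F.obj z).X} (hE : IsComonCone F E g) (e : L.pt ⟶ E)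
    (heg : ∀ z, e.hom ≫ g z = (L.π.app z).hom) : Mono e.hom := by
  let r : E ⟶ L.pt := hL.lift hE.cone
  have hr (z : Z) : r ≫ L.π.app z = hE.cone.π.app z := hL.fac _ _
  have he : e ≫ r = 𝟙 L.pt := hL.hom_ext fun z => by
    rw [Category.assoc, hr, Category.id_comp]
    exact Comon.ext (heg z)
  exact mono_of_mono_fac (h := 𝟙 L.pt.X) congr(($he).hom)

/-- The iterated comultiplications of a limit of coalgebras, composed with tensor products of
projections along words, are jointly monic. -/
theorem jointlyMonic_wordComul_of_isLimit (hV : HasVeryFlatTensor V) [HasLimitsOfSize.{v, v} V]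
    [WellPowered.{v} V] {L : Cone F} (hL : IsLimit L) :
    JointlyMonic (wordComul L.pt fun z => (L.π.app z).hom) := by
  obtain ⟨E, e, g, _, heg, hg⟩ := exists_reduced_quotient hV L.pt fun z => (L.π.app z).hom
  have hE : IsComonCone F E g := .of_epi_comp e g (by
    simpa only [heg] using isComonCone_of_cone L)
  have := hE.mono_of_isLimit hL e heg
  have h : (fun l => e.hom ≫ wordComul E g l) = wordComul L.pt fun z => (L.π.app z).hom :=
    funext (comp_wordComul e _ g heg)
  exact h ▸ hg.mono_comp e.hom

end Limits

/-! ### From words to finite families -/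

section Fin

variable {I : Type w} {Y : I → V}

lemma iterComul_succ_tensorFinMap (C : Comon V) (f : ∀ i, C.X ⟶ Y i) {n : ℕ}
    (s : Fin (n + 1) → I) :
    iterComul C (n + 1) ≫ tensorFinMap (fun i => f (s i)) =
      ComonObj.comul ≫ ((iterComul C n ≫ tensorFinMap (fun i : Fin n => f (s i.castSucc))) ⊗ₘ
        f (s (Fin.last n))) := by
  rw [← whiskerRight_comp_tensorHom]
  exact Category.assoc _ _ _

/-- The two tensor products agree only after reindexing. A comparison `θ` in this one direction
already suffices to transfer joint monicity. -/
lemma exists_fin_of_word (C : Comon V) (f : ∀ i, C.X ⟶ Y i) (l : List I) :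
    ∃ (n : ℕ) (s : Fin n → I) (θ : tensorFin (fun i => Y (s i)) ⟶ wordTensor Y l),
      (iterComul C n ≫ tensorFinMap fun i => f (s i)) ≫ θ = wordComul C f l := by
  induction l with
  | nil => exact ⟨0, Fin.elim0, 𝟙 (𝟙_ V), (Category.comp_id _).trans (Category.comp_id _)⟩
  | cons i l ih =>
    obtain ⟨n, s, θ, h⟩ := ih
    -- Substituting for `s` and `i` avoids transporting objects along equalities of indices. The
    -- head of the list is the last tensor factor, hence `Fin.snoc`.
    obtain ⟨s', rfl, rfl⟩ : ∃ s' : Fin (n + 1) → I,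
        (fun j => s' j.castSucc) = s ∧ s' (Fin.last n) = i :=
      ⟨Fin.snoc s i, by simp, by simp⟩
    refine ⟨n + 1, s', θ ▷ Y (s' (Fin.last n)), ?_⟩
    rw [iterComul_succ_tensorFinMap]
    refine (Category.assoc _ _ _).trans ?_
    change ComonObj.comul ≫ _ ≫ (θ ▷ Y (s' (Fin.last n))) =
      ComonObj.comul ≫ (wordComul C f l ⊗ₘ f (s' (Fin.last n)))
    rw [← h]
    exact congr(ComonObj.comul ≫ $(tensorHom_comp_whiskerRight _ _ _))

lemma JointlyMonic.iterComul_of_wordComul {C : Comon V} {f : ∀ i, C.X ⟶ Y i}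
    (h : JointlyMonic (wordComul C f)) :
    JointlyMonic fun s : (Σ n : ℕ, Fin n → I) =>
      iterComul C s.1 ≫ tensorFinMap fun i : Fin s.1 => f (s.2 i) := fun A a b hab =>
  h a b fun l => by
    obtain ⟨n, s, θ, hθ⟩ := exists_fin_of_word C f l
    rw [← hθ, ← Category.assoc, hab ⟨n, s⟩, Category.assoc]

end Fin

/-! ### The limit inside the cofree coalgebra -/

section Subcoalgebras

variable {Z : Type v} [SmallCategory Z] {F : Z ⥤ Comon V} {Tc : V ⥤ Comon V}
  (adj : Comon.forget V ⊣ Tc) {L' : Cone (F ⋙ Comon.forget V)}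

/-- The morphism underlying the counit, with the forgetful functor unfolded. -/
def cofreeCounit (A : V) : (Tc.obj A).X ⟶ A :=
  adj.counit.app A

/-- The coalgebra morphism to a cofree coalgebra induced by a morphism in `V`. -/
def cofreeLift {C : Comon V} {A : V} (f : C.X ⟶ A) : C ⟶ Tc.obj A :=
  adj.homEquiv C A f

lemma cofreeLift_counit {C : Comon V} {A : V} (f : C.X ⟶ A) :
    (cofreeLift adj f).hom ≫ cofreeCounit adj A = f :=
  (adj.homEquiv_counit (g := adj.homEquiv C A f)).symm.trans (Equiv.symm_apply_apply _ _)

lemma hom_ext_of_counit {A : V} {C : Comon V} {a b : C ⟶ Tc.obj A}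
    (h : a.hom ≫ cofreeCounit adj A = b.hom ≫ cofreeCounit adj A) : a = b :=
  (adj.homEquiv _ _).symm.injective (by
    rw [adj.homEquiv_counit, adj.homEquiv_counit]
    exact h)

variable (L') in
/-- The legs of a cone over `UF`, with the forgetful functor unfolded. -/
def coneLeg (z : Z) : L'.pt ⟶ (F.obj z).X :=
  L'.π.app z

lemma coneLeg_map {z z' : Z} (a : z ⟶ z') : coneLeg L' z ≫ (F.map a).hom = coneLeg L' z' :=
  L'.w a

lemma projHom_eq (S : Subcoalgebra (Tc.obj L'.pt)) (z : Z) :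
    projHom F adj L' S z = S.ι.hom ≫ cofreeCounit adj L'.pt ≫ coneLeg L' z :=
  rfl

lemma isComonCone_projHom {S : Subcoalgebra (Tc.obj L'.pt)} (hS : ProjectsToCoalg F adj L' S) :
    IsComonCone F S.obj (projHom F adj L' S) :=
  ⟨hS, fun z z' a => by
    rw [projHom_eq, projHom_eq, Category.assoc, Category.assoc, coneLeg_map]⟩

/-- The morphism from the vertex of a cone of coalgebras to the limit of the underlying objects. -/
def toLimit (hL' : IsLimit L') (L : Cone F) : L.pt.X ⟶ L'.pt :=
  hL'.lift ((Comon.forget V).mapCone L)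

lemma toLimit_coneLeg (hL' : IsLimit L') (L : Cone F) (z : Z) :
    toLimit hL' L ≫ coneLeg L' z = (L.π.app z).hom :=
  hL'.fac _ z

/-- The canonical morphism from a cone `L` of coalgebras to the cofree coalgebra on the limit
of the underlying objects. -/
def toCofree (hL' : IsLimit L') (L : Cone F) : L.pt ⟶ Tc.obj L'.pt :=
  cofreeLift adj (toLimit hL' L)

lemma toCofree_counit_coneLeg (hL' : IsLimit L') (L : Cone F) (z : Z) :
    (toCofree adj hL' L).hom ≫ cofreeCounit adj L'.pt ≫ coneLeg L' z = (L.π.app z).hom := by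
  rw [← Category.assoc, toCofree, cofreeLift_counit, toLimit_coneLeg]

/-- Reduce `L` over the single object `L'`. The quotient map `e` is split mono because `E` is still
a cone, and the lift `j` of `E` to the cofree coalgebra is mono because the jointly monic words of
`E` factor through it. -/
lemma mono_toCofree (hV : HasVeryFlatTensor V) [HasLimitsOfSize.{v, v} V] [WellPowered.{v} V]
    (hL' : IsLimit L') {L : Cone F} (hL : IsLimit L) : Mono (toCofree adj hL' L).hom := by
  obtain ⟨E, e, g, _, heg, hg⟩ := exists_reduced_quotient (I := PUnit.{v + 1})
    (Y := fun _ => L'.pt) hV L.pt fun _ => toLimit hL' L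
  let γ (z : Z) : E.X ⟶ (F.obj z).X := g ⟨⟩ ≫ coneLeg L' z
  have heγ (z : Z) : e.hom ≫ γ z = (L.π.app z).hom := by
    rw [← toLimit_coneLeg hL', ← heg ⟨⟩, Category.assoc]
  have hE : IsComonCone F E γ := .of_epi_comp e γ (by
    simpa only [heγ] using isComonCone_of_cone L)
  have := hE.mono_of_isLimit hL e heγ
  let j : E ⟶ Tc.obj L'.pt := cofreeLift adj (g ⟨⟩)
  have hj : j.hom ≫ cofreeCounit adj L'.pt = g ⟨⟩ := cofreeLift_counit _ _
  have : Mono j.hom := ⟨fun a b hab => hg a b fun l => by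
    have h : j.hom ≫ wordComul _ (fun _ => cofreeCounit adj L'.pt) l = wordComul E g l :=
      comp_wordComul j g _ (fun _ => hj) l
    rw [← h, reassoc_of% hab]⟩
  have hej : e ≫ j = toCofree adj hL' L := hom_ext_of_counit adj <| by
    rw [toCofree, cofreeLift_counit, Comon.comp_hom', Category.assoc, hj, heg]
  rw [← hej]
  exact mono_comp e.hom j.hom

/-- A limit of coalgebras as a subcoalgebra of the cofree coalgebra on the limit of the underlying
objects. -/
@[simps]
def limitSubcoalgebra (hV : HasVeryFlatTensor V) [HasLimitsOfSize.{v, v} V] [WellPowered.{v} V]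
    (hL' : IsLimit L') {L : Cone F} (hL : IsLimit L) : Subcoalgebra (Tc.obj L'.pt) where
  obj := L.pt
  ι := toCofree adj hL' L
  mono := mono_toCofree adj hV hL' hL

lemma limitSubcoalgebra_projHom (hV : HasVeryFlatTensor V) [HasLimitsOfSize.{v, v} V]
    [WellPowered.{v} V] (hL' : IsLimit L') {L : Cone F} (hL : IsLimit L) (z : Z) :
    projHom F adj L' (limitSubcoalgebra adj hV hL' hL) z = (L.π.app z).hom :=
  toCofree_counit_coneLeg adj hL' L z

lemma limitSubcoalgebra_isLargest (hV : HasVeryFlatTensor V) [HasLimitsOfSize.{v, v} V]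
    [WellPowered.{v} V] (hL' : IsLimit L') {L : Cone F} (hL : IsLimit L) :
    Subcoalgebra.IsLargest (ProjectsToCoalg F adj L') (limitSubcoalgebra adj hV hL' hL) := by
  refine ⟨fun z => ?_, fun S hS => ?_⟩
  · rw [limitSubcoalgebra_projHom]
    exact (L.π.app z).isComonHom_hom
  · let r : S.obj ⟶ L.pt := hL.lift (isComonCone_projHom adj hS).cone
    have hr (z : Z) : r.hom ≫ (L.π.app z).hom = projHom F adj L' S z :=
      congr(($(hL.fac (isComonCone_projHom adj hS).cone z)).hom)
    refine ⟨r, hom_ext_of_counit adj <| hL'.hom_ext fun z => ?_⟩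
    change ((r.hom ≫ (toCofree adj hL' L).hom) ≫ cofreeCounit adj L'.pt) ≫ coneLeg L' z =
      (S.ι.hom ≫ cofreeCounit adj L'.pt) ≫ coneLeg L' z
    rw [Category.assoc, Category.assoc, Category.assoc, toCofree_counit_coneLeg]
    exact hr z

lemma Subcoalgebra.hom_ext {T : Comon V} (S : Subcoalgebra T) {C : Comon V} {a b : C ⟶ S.obj}
    (h : a ≫ S.ι = b ≫ S.ι) : a = b := by
  have := S.mono
  exact Comon.ext ((cancel_mono S.ι.hom).1 congr(($h).hom))

/-- A largest subcoalgebra projecting to the coalgebras `F z` is a limit of `F`. -/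
lemma nonempty_isLimit_of_isLargest (hV : HasVeryFlatTensor V) [HasLimitsOfSize.{v, v} V]
    [WellPowered.{v} V] (hL' : IsLimit L') [HasLimit F] {S : Subcoalgebra (Tc.obj L'.pt)}
    (hS : Subcoalgebra.IsLargest (ProjectsToCoalg F adj L') S) :
    Nonempty (IsLimit (isComonCone_projHom adj hS.1).cone) := by
  let L := limit.cone F
  let hL : IsLimit L := limit.isLimit F
  obtain ⟨a, ha⟩ := hS.2 _ (limitSubcoalgebra_isLargest adj hV hL' hL).1
  obtain ⟨b, hb⟩ := (limitSubcoalgebra_isLargest adj hV hL' hL).2 _ hS.1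
  -- Two largest subcoalgebras factor through each other, so they are isomorphic over the cofree
  -- coalgebra.
  have hab : a ≫ b = 𝟙 _ := (limitSubcoalgebra adj hV hL' hL).hom_ext (by
    rw [Category.assoc, hb, ha, Category.id_comp])
  have hba : b ≫ a = 𝟙 _ := S.hom_ext (by
    rw [Category.assoc, ha, hb, Category.id_comp])
  refine ⟨hL.ofIsoLimit (Cone.ext ⟨a, b, hab, hba⟩ fun z => Comon.ext ?_)⟩
  let a' : L.pt.X ⟶ S.obj.X := a.hom
  have ha' : a' ≫ S.ι.hom = (toCofree adj hL' L).hom := congr(($ha).hom)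
  have h := toCofree_counit_coneLeg adj hL' L z
  rw [← ha', Category.assoc] at h
  exact h.symm

end Subcoalgebras

end CoalgLimits

theorem corollary2p5 {V : Type u} [Category.{v} V] [MonoidalCategory V] [MonoidalClosed V]
    [IsLocallyPresentable.{v} V] (hV : CoalgLimits.HasVeryFlatTensor V)
    {Z : Type v} [SmallCategory Z] (F : Z ⥤ Comon V) :
    -- cofree coalgebras and the two limits exist
    ((Comon.forget V).IsLeftAdjoint ∧ HasLimit F ∧ HasLimit (F ⋙ Comon.forget V)) ∧
    -- for every choice of the cofree functor `Tᶜ` and of the limit `L'` of `UF`: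
    (∀ (Tc : V ⥤ Comon V) (adj : Comon.forget V ⊣ Tc)
        (L' : Cone (F ⋙ Comon.forget V)) (_ : IsLimit L'),
      -- the largest subcoalgebra exists
      (∃ S : CoalgLimits.Subcoalgebra (Tc.obj L'.pt),
        CoalgLimits.Subcoalgebra.IsLargest (CoalgLimits.ProjectsToCoalg F adj L') S) ∧
      -- the largest subcoalgebra, with the composites `π_Z`, is a limit of `F`
      (∀ S : CoalgLimits.Subcoalgebra (Tc.obj L'.pt),
        CoalgLimits.Subcoalgebra.IsLargest (CoalgLimits.ProjectsToCoalg F adj L') S →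
        ∃ π : (Functor.const Z).obj S.obj ⟶ F,
          (∀ z : Z, (π.app z).hom = CoalgLimits.projHom F adj L' S z) ∧
          Nonempty (IsLimit (Cone.mk S.obj π))) ∧
      -- every limit of `F` is the largest subcoalgebra, with the composites as its projections
      (∀ (L : Cone F) (_ : IsLimit L),
        ∃ (i : L.pt ⟶ Tc.obj L'.pt) (hi : Mono i.hom),
          CoalgLimits.Subcoalgebra.IsLargest (CoalgLimits.ProjectsToCoalg F adj L') ⟨L.pt, i, hi⟩ ∧
          ∀ z : Z, (L.π.app z).hom = CoalgLimits.projHom F adj L' ⟨L.pt, i, hi⟩ z)) ∧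
    -- the family `(π_{Z₁} ⊗ ⋯ ⊗ π_{Zₙ}) ∘ Δⁿ` is jointly monic in `V`
    (∀ (L : Cone F) (_ : IsLimit L),
      CoalgLimits.JointlyMonic (fun s : (Σ n : ℕ, Fin n → Z) =>
        CoalgLimits.iterComul L.pt s.1 ≫
          CoalgLimits.tensorFinMap (fun i : Fin s.1 => (L.π.app (s.2 i)).hom))) := by
  have := CoalgLimits.hasColimits_of_isLocallyPresentable V
  have := CoalgLimits.hasLimits_of_isLocallyPresentable V
  have := CoalgLimits.wellPowered_of_isLocallyPresentable V
  have := CoalgLimits.hasLimit_comon hV F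
  refine ⟨⟨CoalgLimits.isLeftAdjoint_forget hV, this, inferInstance⟩,
    fun Tc adj L' hL' => ⟨⟨_, CoalgLimits.limitSubcoalgebra_isLargest adj hV hL'
      (limit.isLimit F)⟩, fun S hS => ⟨_, fun z => rfl,
        CoalgLimits.nonempty_isLimit_of_isLargest adj hV hL' hS⟩, fun L hL =>
      ⟨CoalgLimits.toCofree adj hL' L, CoalgLimits.mono_toCofree adj hV hL' hL,
        CoalgLimits.limitSubcoalgebra_isLargest adj hV hL' hL, fun z =>
        (CoalgLimits.limitSubcoalgebra_projHom adj hV hL' hL z).symm⟩⟩,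
    fun L hL => (CoalgLimits.jointlyMonic_wordComul_of_isLimit hV hL).iterComul_of_wordComul⟩
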